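/- For subspaces $A,B$ of a complex normed space $E$, let $B_1(\cdot)$ denote the closed unit ball and let $$d_{KK}(A,B)=\max\Big\{\sup_{x\in B_1(A)}\operatorname{dist}(x,B_1(B)),\ \sup_{y\in B_1(B)}\operatorname{dist}(y,B_1(A))\Big\}$$ be the Kadison–Kastler distance, i.e. the Hausdorff distance between $B_1(A)$ and $B_1(B)$. Let $\mathcal L\subseteq B(\mathcal H)$ be a von Neumann algebra on a complex Hilbert space $\mathcal H$, and let $\mathcal M,\mathcal N$ be von Neumann subalgebras of $\mathcal L$, that is, $*$-subalgebras closed in the weak operator topology (their units may differ from that of $\mathcal L$). Identify the biduals $\mathcal M^{**},\mathcal N^{**}$ with subspaces of the bidual $\mathcal L^{**}$ through the isometric bitransposes $\mathcal M^{**}\to\mathcal L^{**}$, $\mathcal N^{**}\to\mathcal L^{**}$ of the inclusions, where $\mathcal L^{**}$ carries its bidual norm (which is its norm as the enveloping von Neumann algebra of $\mathcal L$). Then $$d_{KK}(\mathcal M,\mathcal N)=d_{KK}(\mathcal M^{**},\mathcal N^{**}),$$ where the left side is computed in $\mathcal L$ and the right side in $\mathcal L^{**}$. -/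

import Mathlib

noncomputable section

/-- The Kadison-Kastler distance between two subspaces `A`, `B` of a normed space: the Hausdorff
distance between their closed unit balls. (Both balls are bounded and contain `0`, so the real
number `Metric.hausdorffDist` is the maximum of the two suprema of point-to-ball distances.) -/
def dKK {E : Type*} [NormedAddCommGroup E] [NormedSpace ℂ E] (A B : Submodule ℂ E) : ℝ :=
  Metric.hausdorffDist ((A : Set E) ∩ Metric.closedBall 0 1) ((B : Set E) ∩ Metric.closedBall 0 1)

/-- The Banach space bidual `E**`. -/
abbrev Bidual (E : Type*) [NormedAddCommGroup E] [NormedSpace ℂ E] : Type _ :=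
  StrongDual ℂ (StrongDual ℂ E)

/-- The transpose `T* : F* → E*`, `φ ↦ φ ∘ T`, of a bounded linear map `T : E → F`. -/
def transposeMap {E F : Type*} [NormedAddCommGroup E] [NormedSpace ℂ E]
    [NormedAddCommGroup F] [NormedSpace ℂ F] (T : E →L[ℂ] F) :
    StrongDual ℂ F →L[ℂ] StrongDual ℂ E :=
  (ContinuousLinearMap.compL ℂ E F ℂ).flip T

/-- The bitranspose `T** : E** → F**` of a bounded linear map `T : E → F`. -/
def bitransposeMap {E F : Type*} [NormedAddCommGroup E] [NormedSpace ℂ E]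
    [NormedAddCommGroup F] [NormedSpace ℂ F] (T : E →L[ℂ] F) : Bidual E →L[ℂ] Bidual F :=
  transposeMap (transposeMap T)

theorem transposeMap_apply {E F : Type*} [NormedAddCommGroup E] [NormedSpace ℂ E]
    [NormedAddCommGroup F] [NormedSpace ℂ F] (T : E →L[ℂ] F) (φ : StrongDual ℂ F) (x : E) :
    transposeMap T φ x = φ (T x) := rfl

theorem bitransposeMap_apply {E F : Type*} [NormedAddCommGroup E] [NormedSpace ℂ E]
    [NormedAddCommGroup F] [NormedSpace ℂ F] (T : E →L[ℂ] F) (z : Bidual E)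
    (φ : StrongDual ℂ F) : bitransposeMap T z φ = z (transposeMap T φ) := rfl

/-- The bidual `A**` of a subspace `A` of `E`, as a subspace of `E**`: the image of the isometric
embedding `i** : A** → E**` induced by the inclusion `i : A → E`. -/
def bidualSubspace {E : Type*} [NormedAddCommGroup E] [NormedSpace ℂ E] (A : Submodule ℂ E) :
    Submodule ℂ (Bidual E) :=
  (bitransposeMap A.subtypeL).range

/-- A von Neumann subalgebra of the von Neumann algebra `L ⊆ B(H)`: a `*`-subalgebra of `L` which
is closed in the weak operator topology of `B(H)`. Its unit, which exists automatically, may be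
smaller than that of `L`. -/
structure VonNeumannSubalgebra {H : Type*} [NormedAddCommGroup H] [InnerProductSpace ℂ H]
    [CompleteSpace H] (L : VonNeumannAlgebra H) extends
    NonUnitalStarSubalgebra ℂ L.toStarSubalgebra where
  isClosed_wot' :
    IsClosed ((fun x : L.toStarSubalgebra =>
      (ContinuousLinearMapWOT.ofCLM (x : H →L[ℂ] H) : H →WOT[ℂ] H)) '' carrier)

/-- The underlying linear subspace of a von Neumann subalgebra of `L`. -/
def VonNeumannSubalgebra.toSubspace {H : Type*} [NormedAddCommGroup H] [InnerProductSpace ℂ H]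
    [CompleteSpace H] {L : VonNeumannAlgebra H} (M : VonNeumannSubalgebra L) :
    Submodule ℂ L.toStarSubalgebra :=
  M.toNonUnitalStarSubalgebra.toNonUnitalSubalgebra.toSubmodule

end

/-! Each distance bounds the other because near points of one ball can be transported. From a space
to its bidual: by Goldstine (`exists_ultrafilter_tendsto_bidual`) a point of the ball of `A**` is a
weak-star limit of points `a` in the ball of `A`. Nearby `b a` in the ball of `B` have a weak-star
cluster point by Banach–Alaoglu, and the norm is weak-star lower semicontinuous
(`exists_mem_bidualSubspace_dist_le`).

Back again: the matrix coefficients `x ↦ ⟪v, j x w⟫` turn `z` in `E**` into an operator `T`. This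
map `z ↦ T` is a linear contraction extending `j`, and it sends `B**` into `j B` when `j B` is
closed in the weak operator topology. It therefore brings a near point of `B**` back to `B`
(`exists_mem_norm_sub_le_bidual`). -/

/-- A point outside the weak closure of a convex set is separated from it by a functional of the
form `B · φ`. -/
theorem exists_weakBilin_separating {E F : Type*} [AddCommGroup E] [Module ℂ E] [Module ℝ E]
    [IsScalarTower ℝ ℂ E] [AddCommGroup F] [Module ℂ F] (B : E →ₗ[ℂ] F →ₗ[ℂ] ℂ)
    {s : Set (WeakBilin B)} (hs : Convex ℝ s) {z : WeakBilin B} (hz : z ∉ closure s) :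
    ∃ (φ : F) (u : ℝ), (∀ x ∈ s, (B x φ).re < u) ∧ u < (B z φ).re := by
  have : ContinuousSMul ℝ (WeakBilin B) := IsScalarTower.continuousSMul ℂ
  obtain ⟨f, u, hf, hu⟩ := RCLike.geometric_hahn_banach_closed_point (𝕜 := ℂ)
    hs.closure isClosed_closure hz
  obtain ⟨φ, rfl⟩ := LinearMap.dualEmbedding_surjective B f
  exact ⟨φ, u, fun x hx => hf x (subset_closure hx), hu⟩

open Filter Topology in
/-- If `B z ·` is bounded by the support functional of the image of a convex set `s`, then `z` is the
limit of an ultrafilter on `s` for the weak topology given by the pairing `B`. -/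
theorem exists_ultrafilter_tendsto_pairing {X E F : Type*} [AddCommGroup X] [Module ℂ X]
    [AddCommGroup E] [Module ℂ E] [AddCommGroup F] [Module ℂ F] (B : E →ₗ[ℂ] F →ₗ[ℂ] ℂ)
    (ι : X →ₗ[ℂ] E) {s : Set X} (hs : Convex ℝ s) (z : E)
    (h : ∀ (φ : F) (u : ℝ), (∀ x ∈ s, (B (ι x) φ).re < u) → (B z φ).re ≤ u) :
    ∃ U : Ultrafilter X, s ∈ U ∧
      ∀ φ : F, Tendsto (fun x => B (ι x) φ) U (𝓝 (B z φ)) := by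
  let ι' : X → WeakBilin B := ι
  let z' : WeakBilin B := z
  have hconv : Convex ℝ (ι' '' s) := hs.linear_image (ι.restrictScalars ℝ)
  have hmem : z' ∈ closure (ι' '' s) := by
    by_contra hcon
    obtain ⟨φ, u, hf, hzφ⟩ := exists_weakBilin_separating B hconv hcon
    exact (h φ u fun x hx => hf _ ⟨x, hx, rfl⟩).not_gt hzφ
  obtain ⟨V, hV, hVz⟩ := mem_closure_iff_ultrafilter.1 hmem
  refine ⟨Ultrafilter.ofComapInfPrincipal hV, Ultrafilter.ofComapInfPrincipal_mem hV, fun φ => ?_⟩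
  have h1 : Tendsto (fun y : WeakBilin B => B y φ) (𝓝 z') (𝓝 (B z φ)) :=
    (WeakBilin.eval_continuous B φ).tendsto z'
  have h2 : Tendsto ι' (Ultrafilter.ofComapInfPrincipal hV) V :=
    (congrArg (fun W : Ultrafilter (WeakBilin B) => W.toFilter)
      (Ultrafilter.ofComapInfPrincipal_eq_of_map hV)).le
  exact h1.comp (h2.mono_right hVz)

open Filter Topology NormedSpace in
/-- **Goldstine's theorem**: an element of the closed unit ball of the bidual is the weak-star limit
of an ultrafilter on the closed unit ball. -/
theorem exists_ultrafilter_tendsto_bidual {E : Type*} [NormedAddCommGroup E] [NormedSpace ℂ E]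
    (z : Bidual E) (hz : ‖z‖ ≤ 1) :
    ∃ U : Ultrafilter E, (∀ᶠ x in (U : Filter E), ‖x‖ ≤ 1) ∧
      ∀ φ : StrongDual ℂ E, Tendsto (fun x => φ x) U (𝓝 (z φ)) := by
  obtain ⟨U, hU, hUz⟩ := exists_ultrafilter_tendsto_pairing
    (ContinuousLinearMap.coeLM ℂ : Bidual E →ₗ[ℂ] StrongDual ℂ E →ₗ[ℂ] ℂ)
    (inclusionInDoubleDual ℂ E).toLinearMap (convex_closedBall (0 : E) 1) z fun φ u hball => by
      replace hball (x : E) (hx : ‖x‖ ≤ 1) : (φ x).re < u :=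
        hball x (mem_closedBall_zero_iff.2 hx)
      have hu0 : 0 < u := by simpa using hball 0 (by simp)
      have hφ : ‖φ‖ ≤ u := by
        refine ContinuousLinearMap.opNorm_le_of_unit_norm hu0.le fun x hx => ?_
        -- The ball is invariant under phases, so the bound on real parts bounds the modulus.
        obtain ⟨c, hc, hcx⟩ := RCLike.exists_norm_eq_mul_self (φ x)
        have := hball (c • x) (by rw [norm_smul, hc, hx, one_mul])
        rw [map_smul, smul_eq_mul, ← hcx] at this
        exact le_of_lt (by simpa using this)
      have := (Complex.re_le_norm (z φ)).trans ((z.le_opNorm φ).trans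
        (mul_le_mul hz hφ (norm_nonneg φ) zero_le_one))
      rwa [one_mul] at this
  exact ⟨U, by filter_upwards [hU] with x hx using mem_closedBall_zero_iff.1 hx, hUz⟩

/-! ### Passage from subspaces to their biduals -/

/-- The bitranspose of the inclusion of a subspace is isometric. -/
theorem norm_bitransposeMap_subtypeL {E : Type*} [NormedAddCommGroup E] [NormedSpace ℂ E]
    (A : Submodule ℂ E) (w : Bidual A) : ‖bitransposeMap A.subtypeL w‖ = ‖w‖ := by
  apply le_antisymm
  · refine ContinuousLinearMap.opNorm_le_bound _ (norm_nonneg w) fun φ => ?_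
    rw [bitransposeMap_apply]
    refine (w.le_opNorm _).trans (mul_le_mul_of_nonneg_left ?_ (norm_nonneg _))
    exact ContinuousLinearMap.opNorm_le_bound _ (norm_nonneg _) fun x => φ.le_opNorm (x : E)
  · refine ContinuousLinearMap.opNorm_le_bound _ (norm_nonneg (bitransposeMap A.subtypeL w)) fun ψ => ?_
    obtain ⟨φ, hφ, hn⟩ := exists_extension_norm_eq A ψ
    have hψ : transposeMap A.subtypeL φ = ψ := ContinuousLinearMap.ext hφ
    rw [← hn, ← hψ, ← bitransposeMap_apply]
    exact ContinuousLinearMap.le_opNorm _ φ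

open Filter Topology NormedSpace in
/-- If the unit ball of `A` lies within `r` of the unit ball of `B`, the same holds for the
biduals. -/
theorem exists_mem_bidualSubspace_dist_le {E : Type*} [NormedAddCommGroup E] [NormedSpace ℂ E]
    {A B : Submodule ℂ E} {r : ℝ}
    (h : ∀ x ∈ (A : Set E) ∩ Metric.closedBall 0 1,
      ∃ y ∈ (B : Set E) ∩ Metric.closedBall 0 1, dist x y ≤ r) :
    ∀ x ∈ (bidualSubspace A : Set (Bidual E)) ∩ Metric.closedBall 0 1,
      ∃ y ∈ (bidualSubspace B : Set (Bidual E)) ∩ Metric.closedBall 0 1, dist x y ≤ r := by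
  rintro _ ⟨⟨w, rfl⟩, hw⟩
  replace hw : ‖w‖ ≤ 1 := by
    rw [← norm_bitransposeMap_subtypeL A w]
    exact (mem_closedBall_zero_iff (E := Bidual E)).1 hw
  obtain ⟨U, hU, hUw⟩ := exists_ultrafilter_tendsto_bidual w hw
  have hr : 0 ≤ r := by
    obtain ⟨y, -, hy⟩ := h 0 (by simp)
    exact dist_nonneg.trans hy
  -- The value `0` off the unit ball makes `b` total with `‖b a‖ ≤ 1` everywhere; `U` only sees the
  -- ball.
  have h' (a : A) : ∃ b : B, ‖b‖ ≤ 1 ∧ (‖a‖ ≤ 1 → ‖(a : E) - b‖ ≤ r) := by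
    by_cases ha : ‖a‖ ≤ 1
    · obtain ⟨y, ⟨hyB, hy⟩, hd⟩ := h a ⟨a.2, by simpa using ha⟩
      exact ⟨⟨y, hyB⟩, by simpa using hy, fun _ => by rwa [← dist_eq_norm]⟩
    · exact ⟨0, by simp, fun h => absurd h ha⟩
  choose b hb hab using h'
  obtain ⟨y, hy, hyU⟩ := (WeakDual.isCompact_closedBall (𝕜 := ℂ)
    (0 : StrongDual ℂ (StrongDual ℂ B)) 1).ultrafilter_le_nhds
    (U.map fun a => StrongDual.toWeakDual (inclusionInDoubleDual ℂ B (b a)))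
    (by
      rw [le_principal_iff]
      refine mem_map.2 (Filter.Eventually.of_forall fun a => ?_)
      simpa using (double_dual_bound ℂ B (b a)).trans (hb a))
  have hyφ (ψ : StrongDual ℂ B) :
      Tendsto (fun a => ψ (b a)) U (𝓝 (WeakDual.toStrongDual y ψ)) :=
    ((WeakDual.eval_continuous ψ).tendsto y).comp hyU
  refine ⟨bitransposeMap B.subtypeL (WeakDual.toStrongDual y), ⟨⟨_, rfl⟩, ?_⟩, ?_⟩
  · refine (mem_closedBall_zero_iff (E := Bidual E)).2 ?_
    rw [norm_bitransposeMap_subtypeL]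
    exact (mem_closedBall_zero_iff (E := Bidual B)).1 hy
  · rw [dist_eq_norm (E := Bidual E)]
    refine ContinuousLinearMap.opNorm_le_bound _ hr fun φ => ?_
    -- Both limits run along the same `U`, so the difference at `φ` is the limit of `φ (a - b a)`,
    -- of modulus at most `‖φ‖ * r`.
    have hlim := ((hUw (transposeMap A.subtypeL φ)).sub (hyφ (transposeMap B.subtypeL φ))).norm
    refine le_of_tendsto hlim ?_
    filter_upwards [hU] with a ha
    have : transposeMap A.subtypeL φ a - transposeMap B.subtypeL φ (b a) = φ ((a : E) - b a) :=
      (map_sub φ _ _).symm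
    rw [this, mul_comm]
    exact (φ.le_opNorm _).trans (mul_le_mul_of_nonneg_left (hab a ha) (norm_nonneg _))

/-! ### Return from biduals through matrix coefficients -/

section Pairing

variable {E H : Type*} [NormedAddCommGroup E] [NormedSpace ℂ E] [NormedAddCommGroup H]
  [InnerProductSpace ℂ H] (j : E →L[ℂ] H →L[ℂ] H)

/-- The functional `x ↦ ⟪v, j x w⟫` attached to a family `j` of operators. -/
noncomputable def matrixCoeff (v w : H) : StrongDual ℂ E :=
  (innerSL ℂ v).comp (j.flip w)

theorem matrixCoeff_apply (v w : H) (x : E) : matrixCoeff j v w x = inner ℂ v (j x w) := rfl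

theorem norm_matrixCoeff_le (v w : H) : ‖matrixCoeff j v w‖ ≤ ‖j‖ * ‖v‖ * ‖w‖ := by
  refine ContinuousLinearMap.opNorm_le_bound _ (by positivity) fun x => ?_
  calc ‖inner ℂ v (j x w)‖ ≤ ‖v‖ * ‖j x w‖ := norm_inner_le_norm _ _
    _ ≤ ‖v‖ * (‖j‖ * ‖x‖ * ‖w‖) := by gcongr; exact j.le_opNorm₂ x w
    _ = _ := by ring

/-- The operator with matrix coefficients `z (x ↦ ⟪v, j x w⟫)`. -/
theorem exists_inner_eq_bidual [CompleteSpace H] (z : Bidual E) :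
    ∃ T : H →L[ℂ] H, ∀ v w, inner ℂ v (T w) = z (matrixCoeff j v w) := by
  let B : H →L⋆[ℂ] H →L[ℂ] ℂ := LinearMap.mkContinuous₂
    (LinearMap.mk₂'ₛₗ (starRingEnd ℂ) (RingHom.id ℂ) (fun v w => z (matrixCoeff j v w))
      (fun v v' w => by rw [← map_add]; congr 1; ext x; simp [matrixCoeff_apply])
      (fun c v w => by
        rw [show matrixCoeff j (c • v) w = starRingEnd ℂ c • matrixCoeff j v w by
          ext x; simp [matrixCoeff_apply, mul_comm], map_smul])
      (fun v w w' => by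
        rw [← map_add]; congr 1; ext x; simp [matrixCoeff_apply])
      (fun c v w => by
        rw [show matrixCoeff j v (c • w) = c • matrixCoeff j v w by
          ext x; simp [matrixCoeff_apply], map_smul, RingHom.id_apply]))
    (‖z‖ * ‖j‖) (fun v w => by
      calc ‖z (matrixCoeff j v w)‖ ≤ ‖z‖ * ‖matrixCoeff j v w‖ := z.le_opNorm _
        _ ≤ ‖z‖ * (‖j‖ * ‖v‖ * ‖w‖) := by gcongr; exact norm_matrixCoeff_le j v w
        _ = _ := by ring)
  -- The Riesz operator of `B` represents it as `⟪S v, w⟫`; the adjoint moves it to the second slot.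
  refine ⟨ContinuousLinearMap.adjoint (InnerProductSpace.continuousLinearMapOfBilin B),
    fun v w => ?_⟩
  rw [ContinuousLinearMap.adjoint_inner_right, InnerProductSpace.continuousLinearMapOfBilin_apply]
  rfl


open Filter Topology NormedSpace in
/-- Let `j : E → B(H)` be isometric and let `A ⊆ E` be a subspace whose image is closed in the weak
operator topology. Then the elements of the unit ball of `A**` can be pushed back to `A` without
increasing their distance to any element of `E`. -/
theorem exists_mem_norm_sub_le_bidual [CompleteSpace H] (hj : ∀ x, ‖j x‖ = ‖x‖)
    (A : Submodule ℂ E)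
    (hA : IsClosed ((fun x => (ContinuousLinearMapWOT.ofCLM (j x) : H →WOT[ℂ] H)) '' (A : Set E)))
    (z : Bidual E) (hzA : z ∈ bidualSubspace A) (hz : ‖z‖ ≤ 1) :
    ∃ y ∈ A, ∀ x : E, ‖x - y‖ ≤ ‖inclusionInDoubleDual ℂ E x - z‖ := by
  obtain ⟨T, hT⟩ := exists_inner_eq_bidual j z
  obtain ⟨w, rfl⟩ := hzA
  replace hz : ‖w‖ ≤ 1 := (norm_bitransposeMap_subtypeL A w).symm.trans_le hz
  obtain ⟨U, -, hUw⟩ := exists_ultrafilter_tendsto_bidual w hz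
  have hlim : Tendsto (fun a : A => (ContinuousLinearMapWOT.ofCLM (j a) : H →WOT[ℂ] H)) U
      (𝓝 (ContinuousLinearMapWOT.ofCLM T)) := by
    refine ContinuousLinearMapWOT.tendsto_iff_forall_dual_apply_tendsto.2 fun h f => ?_
    obtain ⟨v, rfl⟩ := (InnerProductSpace.toDual ℂ H).surjective f
    have := hUw (transposeMap A.subtypeL (matrixCoeff j v h))
    exact this.trans (congrArg 𝓝 (hT v h).symm).le
  -- Closedness of the image of `A` puts the limit `T` in it.
  obtain ⟨y, hyA, hy⟩ := hA.mem_of_tendsto hlim (Eventually.of_forall fun a => ⟨a, a.2, rfl⟩)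
  have hyT : j y = T := ContinuousLinearMapWOT.ofCLM_injective hy
  refine ⟨y, hyA, fun x => ?_⟩
  set z := bitransposeMap A.subtypeL w
  rw [← hj, map_sub, hyT]
  have hj1 : ‖j‖ ≤ 1 := j.opNorm_le_bound zero_le_one fun x => by rw [hj, one_mul]
  refine ContinuousLinearMap.opNorm_le_of_re_inner_le
    (norm_nonneg (inclusionInDoubleDual ℂ E x - z)) fun h v hh hv => ?_
  rw [inner_re_symm]
  have hval : inner ℂ v ((j x - T) h) = (inclusionInDoubleDual ℂ E x - z) (matrixCoeff j v h) := by
    rw [sub_apply, inner_sub_right, hT]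
    rfl
  rw [hval]
  calc _ ≤ ‖(inclusionInDoubleDual ℂ E x - z) (matrixCoeff j v h)‖ := RCLike.re_le_norm _
    _ ≤ ‖inclusionInDoubleDual ℂ E x - z‖ * ‖matrixCoeff j v h‖ :=
      ContinuousLinearMap.le_opNorm _ _
    _ ≤ ‖inclusionInDoubleDual ℂ E x - z‖ * 1 := by
      refine mul_le_mul_of_nonneg_left ?_ (norm_nonneg (inclusionInDoubleDual ℂ E x - z))
      have := norm_matrixCoeff_le j v h
      rw [hh, hv, mul_one, mul_one] at this
      exact this.trans hj1
    _ = _ := mul_one _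

open NormedSpace in
/-- If the unit ball of `A**` lies within `r` of the unit ball of `B**` and `B` is closed in the weak
operator topology, then the unit ball of `A` lies within `r` of the unit ball of `B`. -/
theorem exists_mem_dist_le_of_bidualSubspace [CompleteSpace H] (hj : ∀ x, ‖j x‖ = ‖x‖)
    {A B : Submodule ℂ E} {r : ℝ}
    (hB : IsClosed ((fun x => (ContinuousLinearMapWOT.ofCLM (j x) : H →WOT[ℂ] H)) '' (B : Set E)))
    (h : ∀ x ∈ (bidualSubspace A : Set (Bidual E)) ∩ Metric.closedBall 0 1,
      ∃ y ∈ (bidualSubspace B : Set (Bidual E)) ∩ Metric.closedBall 0 1, dist x y ≤ r) :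
    ∀ x ∈ (A : Set E) ∩ Metric.closedBall 0 1,
      ∃ y ∈ (B : Set E) ∩ Metric.closedBall 0 1, dist x y ≤ r := by
  rintro x ⟨hxA, hx⟩
  obtain ⟨z, ⟨hzB, hz⟩, hxz⟩ := h (inclusionInDoubleDual ℂ E x)
    ⟨⟨inclusionInDoubleDual ℂ A ⟨x, hxA⟩, rfl⟩, (mem_closedBall_zero_iff (E := Bidual E)).2
      ((double_dual_bound ℂ E x).trans (mem_closedBall_zero_iff.1 hx))⟩
  replace hz : ‖z‖ ≤ 1 := (mem_closedBall_zero_iff (E := Bidual E)).1 hz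
  obtain ⟨y, hyB, hy⟩ := exists_mem_norm_sub_le_bidual j hj B hB z hzB hz
  refine ⟨y, ⟨hyB, mem_closedBall_zero_iff.2 ?_⟩, ?_⟩
  -- The estimate at `x = 0` reads `‖y‖ ≤ ‖z‖`.
  · have h0 := hy 0
    rw [map_zero, zero_sub, norm_neg, zero_sub (G := Bidual E), norm_neg (E := Bidual E)] at h0
    exact h0.trans hz
  · rw [dist_eq_norm (E := Bidual E)] at hxz
    rw [dist_eq_norm]
    exact (hy x).trans hxz

end Pairing

/-! ### Comparison of the distances -/

/-- The Kadison-Kastler distance is below every `r` exceeding a number `d` as soon as the unit balls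
are mutually within every `r > d`. -/
theorem dKK_le_of_forall_gt {E : Type*} [NormedAddCommGroup E] [NormedSpace ℂ E]
    {A B : Submodule ℂ E} {d : ℝ} (hd : 0 ≤ d)
    (hAB : ∀ r > d, ∀ x ∈ (A : Set E) ∩ Metric.closedBall 0 1,
      ∃ y ∈ (B : Set E) ∩ Metric.closedBall 0 1, dist x y ≤ r)
    (hBA : ∀ r > d, ∀ x ∈ (B : Set E) ∩ Metric.closedBall 0 1,
      ∃ y ∈ (A : Set E) ∩ Metric.closedBall 0 1, dist x y ≤ r) : dKK A B ≤ d :=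
  le_of_forall_gt_imp_ge_of_dense fun r hr =>
    Metric.hausdorffDist_le_of_mem_dist (hd.trans hr.le) (hAB r hr) (hBA r hr)

theorem dKK_comm {E : Type*} [NormedAddCommGroup E] [NormedSpace ℂ E] (A B : Submodule ℂ E) :
    dKK A B = dKK B A := Metric.hausdorffDist_comm

theorem exists_dist_le_of_dKK_lt {E : Type*} [NormedAddCommGroup E] [NormedSpace ℂ E]
    {A B : Submodule ℂ E} {r : ℝ} (hr : dKK A B < r) :
    ∀ x ∈ (A : Set E) ∩ Metric.closedBall 0 1,
      ∃ y ∈ (B : Set E) ∩ Metric.closedBall 0 1, dist x y ≤ r := by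
  intro x hx
  have hfin := Metric.hausdorffEDist_ne_top_of_nonempty_of_bounded ⟨x, hx⟩
    (⟨0, B.zero_mem, by simp⟩ : ((B : Set E) ∩ Metric.closedBall 0 1).Nonempty)
    (Metric.isBounded_closedBall.subset Set.inter_subset_right)
    (Metric.isBounded_closedBall.subset Set.inter_subset_right)
  obtain ⟨y, hy, hxy⟩ := Metric.exists_dist_lt_of_hausdorffDist_lt hx hr hfin
  exact ⟨y, hy, hxy.le⟩

/-- The Kadison-Kastler distance of two subspaces of an isometrically represented space of operators
which are closed in the weak operator topology equals that of their biduals. -/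
theorem dKK_eq_dKK_bidualSubspace {E H : Type*} [NormedAddCommGroup E] [NormedSpace ℂ E]
    [NormedAddCommGroup H] [InnerProductSpace ℂ H] [CompleteSpace H]
    (j : E →L[ℂ] H →L[ℂ] H) (hj : ∀ x, ‖j x‖ = ‖x‖) {A B : Submodule ℂ E}
    (hA : IsClosed ((fun x => (ContinuousLinearMapWOT.ofCLM (j x) : H →WOT[ℂ] H)) '' (A : Set E)))
    (hB : IsClosed ((fun x => (ContinuousLinearMapWOT.ofCLM (j x) : H →WOT[ℂ] H)) '' (B : Set E))) :
    dKK A B = dKK (E := Bidual E) (bidualSubspace A) (bidualSubspace B) := by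
  apply le_antisymm
  · refine dKK_le_of_forall_gt Metric.hausdorffDist_nonneg (fun r hr => ?_) fun r hr => ?_
    · exact exists_mem_dist_le_of_bidualSubspace j hj hB (exists_dist_le_of_dKK_lt hr)
    · rw [dKK_comm] at hr
      exact exists_mem_dist_le_of_bidualSubspace j hj hA (exists_dist_le_of_dKK_lt hr)
  · refine dKK_le_of_forall_gt Metric.hausdorffDist_nonneg (fun r hr => ?_) fun r hr => ?_
    · exact exists_mem_bidualSubspace_dist_le (exists_dist_le_of_dKK_lt hr)
    · rw [dKK_comm] at hr
      exact exists_mem_bidualSubspace_dist_le (exists_dist_le_of_dKK_lt hr)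

/-- The inclusion of a `*`-subalgebra of `B(H)` into `B(H)`, as a bounded linear map. -/
noncomputable def StarSubalgebra.inclusionL {H : Type*} [NormedAddCommGroup H]
    [InnerProductSpace ℂ H] [CompleteSpace H] (S : StarSubalgebra ℂ (H →L[ℂ] H)) :
    S →L[ℂ] H →L[ℂ] H :=
  S.subtype.toLinearMap.mkContinuous 1 fun x => by rw [one_mul]; rfl

theorem theorem3p4 {H : Type*} [NormedAddCommGroup H] [InnerProductSpace ℂ H] [CompleteSpace H]
    (L : VonNeumannAlgebra H) (M N : VonNeumannSubalgebra L) :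
    dKK (E := L.toStarSubalgebra) M.toSubspace N.toSubspace =
      dKK (E := Bidual L.toStarSubalgebra)
        (bidualSubspace M.toSubspace) (bidualSubspace N.toSubspace) := by
  have hj : ∀ x, ‖L.toStarSubalgebra.inclusionL x‖ = ‖x‖ := fun _ => rfl
  have hM : IsClosed ((fun x => (ContinuousLinearMapWOT.ofCLM (L.toStarSubalgebra.inclusionL x) :
      H →WOT[ℂ] H)) '' (M.toSubspace : Set L.toStarSubalgebra)) := M.isClosed_wot'
  have hN : IsClosed ((fun x => (ContinuousLinearMapWOT.ofCLM (L.toStarSubalgebra.inclusionL x) :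
      H →WOT[ℂ] H)) '' (N.toSubspace : Set L.toStarSubalgebra)) := N.isClosed_wot'
  exact dKK_eq_dKK_bidualSubspace _ hj hM hN
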